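/- Let $p$ be a prime, $k$ an algebraically closed field of characteristic $p$, $W=W_\infty(k)$ its ring of infinite Witt vectors, and $\sigma$ the Frobenius automorphism of $W$. Let $M$ be the covariant Dieudonné module of a principally quasi-polarized formal (local) $p$-divisible group $G$ over $k$ with $p$-rank $f(G)=0$. That is, $M$ is a free $W$-module of finite rank with a $\sigma$-linear map $F$ and a $\sigma^{-1}$-linear map $V$ such that $FV=p=VF$; it carries an alternating perfect $W$-bilinear pairing $\langle\ ,\ \rangle:M\times M\to W$ with $\langle Fa,b\rangle=\langle a,Vb\rangle^\sigma$ for all $a,b\in M$; $V$ is topologically nilpotent on $M$ for the $p$-adic topology; and $\mathrm{Hom}(\mu_p,G)=\{x\in M/pM : Fx=x,\ Vx=0\}$ is zero. Let $d=\dim_k(M/VM)$ be the dimension of $G$, and suppose that $a(M)=\dim_k\bigl(M/(FM+VM)\bigr)=1$. Then there is a $W$-basis $\{e_1=X_1,\dots,e_d=X_d,\ e_{d+1}=Y_1,\dots,e_{2d}=Y_d\}$ of $M$ which is symplectic, i.e. $\langle X_i,Y_j\rangle=\delta_{ij}$ and $\langle X_i,X_j\rangle=0=\langle Y_i,Y_j\rangle$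 for all $i,j$, and on which $M$ is in displayed form with a display-matrix $(a_{ij})$ in normal form. Displayed form means that $a_{ij}\in W$, $Fe_j=\sum_{i=1}^{2d}a_{ij}e_i$ for $1\le j\le d$ and $e_j=V\bigl(\sum_{i=1}^{2d}a_{ij}e_i\bigr)$ for $d<j\le 2d$. Normal form means that $a_{1,2d}\in W^*$ and the matrix of $F$ on this basis, in blocks of size $d\times d$, is $$\begin{pmatrix} A & pB\\ C & pD\end{pmatrix},$$ where: $A$ has last column $(a_{1,d},\dots,a_{d,d})^t$, entries $1$ immediately below the diagonal, and $0$ elsewhere in the first $d-1$ columns; $B=(a_{ij})_{1\le i\le d<j\le 2d}$ is unspecified; $C$ has a single nonzero entry, equal to $1$, in its right upper corner (first row, last column); and $D$ has entries $1$ immediately below the diagonal and $0$ elsewhere. -/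

import Mathlib

noncomputable section

namespace Dieudonne

section FrobeniusOnWitt

variable (p : ℕ) [Fact p.Prime] (k : Type*) [Field k] [CharP k p] [PerfectRing k p]

/-- The Frobenius automorphism `σ` of the ring `W = W(k)` of infinite Witt vectors of a perfect
field `k` of characteristic `p`, as a ring homomorphism. -/
def sigma : WittVector p k →+* WittVector p k :=
  WittVector.frobenius

/-- The inverse `τ = σ⁻¹` of the Frobenius automorphism of `W(k)`. -/
def tau : WittVector p k →+* WittVector p k :=
  ((WittVector.frobeniusEquiv p k).symm : WittVector p k →+* WittVector p k)

instance sigma_surjective : RingHomSurjective (sigma p k) :=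
  ⟨(WittVector.frobeniusEquiv p k).surjective⟩

instance tau_surjective : RingHomSurjective (tau p k) :=
  ⟨(WittVector.frobeniusEquiv p k).symm.surjective⟩

@[simp] lemma sigma_tau (x : WittVector p k) : sigma p k (tau p k x) = x :=
  (WittVector.frobeniusEquiv p k).apply_symm_apply x

@[simp] lemma tau_sigma (x : WittVector p k) : tau p k (sigma p k x) = x :=
  (WittVector.frobeniusEquiv p k).symm_apply_apply x

end FrobeniusOnWitt

end Dieudonne

/-- The structure of a (covariant) Dieudonné module on a module `M` over `W = W(k)`, `k` perfect of
characteristic `p`: a `σ`-linear map `F` and a `σ⁻¹`-linear map `V` with `F V = p = V F`.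
The Dieudonné modules of `p`-divisible groups over `k` are those whose underlying `W`-module is
free of finite rank (the rank being the height of the group). -/
structure DieudonneModule (p : ℕ) [Fact p.Prime] (k : Type*) [Field k] [CharP k p]
    [PerfectRing k p] (M : Type*) [AddCommGroup M] [Module (WittVector p k) M] where
  F : M →ₛₗ[Dieudonne.sigma p k] M
  V : M →ₛₗ[Dieudonne.tau p k] M
  F_V : ∀ x : M, F (V x) = (p : WittVector p k) • x
  V_F : ∀ x : M, V (F x) = (p : WittVector p k) • x

namespace DieudonneModule

variable {p : ℕ} [Fact p.Prime] {k : Type*} [Field k] [CharP k p] [PerfectRing k p]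
  {M : Type*} [AddCommGroup M] [Module (WittVector p k) M]

/-- The submodule `pM`. -/
def pM (p : ℕ) [Fact p.Prime] (k : Type*) [Field k] (M : Type*) [AddCommGroup M]
    [Module (WittVector p k) M] : Submodule (WittVector p k) M :=
  LinearMap.range (LinearMap.lsmul (WittVector p k) M (p : WittVector p k))

lemma pM_le_comap_F (D : DieudonneModule p k M) : pM p k M ≤ (pM p k M).comap D.F := by
  rintro _ ⟨x, rfl⟩
  exact ⟨D.F x, by simp⟩

lemma pM_le_comap_V (D : DieudonneModule p k M) : pM p k M ≤ (pM p k M).comap D.V := by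
  rintro _ ⟨x, rfl⟩
  exact ⟨D.V x, by simp⟩

/-- `F` on `M / pM`, the Dieudonné module of the `p`-torsion `G[p]`. -/
def Fmod (D : DieudonneModule p k M) :
    (M ⧸ pM p k M) →ₛₗ[Dieudonne.sigma p k] (M ⧸ pM p k M) :=
  Submodule.mapQ _ _ D.F D.pM_le_comap_F

/-- `V` on `M / pM`. -/
def Vmod (D : DieudonneModule p k M) :
    (M ⧸ pM p k M) →ₛₗ[Dieudonne.tau p k] (M ⧸ pM p k M) :=
  Submodule.mapQ _ _ D.V D.pM_le_comap_V

/-- The group `Hom(μ_p, G)` in terms of Dieudonné modules. In the covariant theory `D(μ_p)` is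
`k · e` with `F e = e`, `V e = 0`, and a homomorphism `μ_p → G` lands in `G[p]`; so it is the same
as an element `x` (the image of `e`) of `D(G[p]) = M / pM` with `F x = x` and `V x = 0`. -/
def homMuP (D : DieudonneModule p k M) : AddSubgroup (M ⧸ pM p k M) where
  carrier := {x | D.Fmod x = x ∧ D.Vmod x = 0}
  zero_mem' := by simp
  add_mem' := by
    rintro x y ⟨hx, hx'⟩ ⟨hy, hy'⟩
    exact ⟨by rw [map_add, hx, hy], by rw [map_add, hx', hy', add_zero]⟩
  neg_mem' := by
    rintro x ⟨hx, hx'⟩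
    exact ⟨by rw [map_neg, hx], by rw [map_neg, hx', neg_zero]⟩

/-- The `p`-rank is `f`: `Hom(μ_p, G) ≅ (ℤ/p)^f` (for `k` algebraically closed). -/
def HasPRank (D : DieudonneModule p k M) (f : ℕ) : Prop :=
  Nonempty (D.homMuP ≃+ (Fin f → ZMod p))

/-- `dim G = dim_k (M / VM)`. This quotient is killed by `p`, so that it is a vector space over
`k = W / pW`; its dimension is its length as a `W`-module. -/
def dimension (D : DieudonneModule p k M) : ℕ∞ :=
  Module.length (WittVector p k) (M ⧸ LinearMap.range D.V)

/-- The `a`-number `a(M) = dim_k (M / (FM + VM))`. Again this quotient is a vector space over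
`k = W / pW`, whose dimension is its length as a `W`-module. -/
def aNumber (D : DieudonneModule p k M) : ℕ∞ :=
  Module.length (WittVector p k) (M ⧸ (LinearMap.range D.F ⊔ LinearMap.range D.V))

/-- The `p`-divisible group is formal (connected, "local"): `V` is topologically nilpotent for the
`p`-adic topology on `M`. -/
def IsFormal (D : DieudonneModule p k M) : Prop :=
  ∃ n : ℕ, ∀ x : M, (D.V)^[n] x ∈ pM p k M

/-- A principal quasi-polarization on a Dieudonné module: a skew (alternating) perfect pairing
`M × M → W` with `⟨F a, b⟩ = ⟨a, V b⟩^σ`. -/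
structure PrincipalQuasiPolarization (D : DieudonneModule p k M) where
  pairing : M →ₗ[WittVector p k] M →ₗ[WittVector p k] WittVector p k
  alternating : ∀ x : M, pairing x x = 0
  perfect : pairing.IsPerfPair
  F_V : ∀ x y : M, pairing (D.F x) y = Dieudonne.sigma p k (pairing x (D.V y))

/-- The basis `{X_1, …, X_d, Y_1, …, Y_d}`, with `X_i = e (inl i)` and `Y_i = e (inr i)`, is
symplectic: `⟨X_i, Y_j⟩ = δ_ij` and `⟨X_i, X_j⟩ = 0 = ⟨Y_i, Y_j⟩`. -/
def PrincipalQuasiPolarization.IsSymplectic {D : DieudonneModule p k M}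
    (B : D.PrincipalQuasiPolarization) {d : ℕ}
    (e : Module.Basis (Fin d ⊕ Fin d) (WittVector p k) M) : Prop :=
  (∀ i j, B.pairing (e (Sum.inl i)) (e (Sum.inr j)) = if i = j then 1 else 0) ∧
  (∀ i j, B.pairing (e (Sum.inl i)) (e (Sum.inl j)) = 0) ∧
  (∀ i j, B.pairing (e (Sum.inr i)) (e (Sum.inr j)) = 0)

/-- The matrix of the `σ`-linear map `F` on a basis: `F e_j = ∑ i, m_ij e_i`. -/
def FMatrix (D : DieudonneModule p k M) {ι : Type*}
    (e : Module.Basis ι (WittVector p k) M) : Matrix ι ι (WittVector p k) :=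
  Matrix.of fun i j => e.repr (D.F (e j)) i

/-- `M` is written in displayed form on the basis `e = {X_1, …, X_d, Y_1, …, Y_c}` with display
matrix `a`: `F e_j = ∑ i, a_ij e_i` for `j ≤ d`, and `e_j = V (∑ i, a_ij e_i)` for `j > d`. -/
def IsDisplayedBy (D : DieudonneModule p k M) {d c : ℕ}
    (e : Module.Basis (Fin d ⊕ Fin c) (WittVector p k) M)
    (a : Matrix (Fin d ⊕ Fin c) (Fin d ⊕ Fin c) (WittVector p k)) : Prop :=
  (∀ j : Fin d, D.F (e (Sum.inl j)) = ∑ i, a i (Sum.inl j) • e i) ∧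
  (∀ j : Fin c, e (Sum.inr j) = D.V (∑ i, a i (Sum.inr j) • e i))

end DieudonneModule

namespace Display

/-- The `F`-matrix `(pa)` associated with a display matrix `(a)` with blocks `A, B, C, D`: it has
blocks `A, pB, C, pD`. -/
def toFMatrix {R : Type*} [CommRing R] (p : ℕ) {d c : ℕ}
    (a : Matrix (Fin d ⊕ Fin c) (Fin d ⊕ Fin c) R) :
    Matrix (Fin d ⊕ Fin c) (Fin d ⊕ Fin c) R :=
  Matrix.fromBlocks a.toBlocks₁₁ ((p : R) • a.toBlocks₁₂) a.toBlocks₂₁ ((p : R) • a.toBlocks₂₂)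

/-- The shape of an `F`-matrix in normal form, blocks of size `d × d`, in terms of the entries
`a_ij` (indices of `Fin d` start at `0`, so that `j + 1 = d` is the last column of a block):
* left upper block: last column `a_{1,d}, …, a_{d,d}`, ones immediately below the diagonal, zeros
  elsewhere;
* right upper block: unspecified entries `p a_ij`;
* left lower block: a single one, in its right upper corner, zeros elsewhere;
* right lower block: `p` immediately below the diagonal, zeros elsewhere. -/
def normalShape {R : Type*} [CommRing R] (p : ℕ) {d : ℕ}
    (a : Matrix (Fin d ⊕ Fin d) (Fin d ⊕ Fin d) R) :
    Matrix (Fin d ⊕ Fin d) (Fin d ⊕ Fin d) R :=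
  Matrix.fromBlocks
    (Matrix.of fun i j => if (j : ℕ) + 1 = d then a (Sum.inl i) (Sum.inl j)
      else if (i : ℕ) = j + 1 then 1 else 0)
    (Matrix.of fun i j => (p : R) * a (Sum.inl i) (Sum.inr j))
    (Matrix.of fun i j => if (i : ℕ) = 0 ∧ (j : ℕ) + 1 = d then 1 else 0)
    (Matrix.of fun i j => if (i : ℕ) = j + 1 then (p : R) else 0)

/-- The display matrix `(a_ij)`, of size `2d × 2d` with blocks of size `d × d`, is in normal form
over `R`: its `F`-matrix has the normal shape, and `a_{1,2d}` (first row, last column) is a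
unit. -/
def IsNormalForm {R : Type*} [CommRing R] (p : ℕ) {d : ℕ}
    (a : Matrix (Fin d ⊕ Fin d) (Fin d ⊕ Fin d) R) : Prop :=
  toFMatrix p a = normalShape p a ∧
  ∀ i j : Fin d, (i : ℕ) = 0 → (j : ℕ) + 1 = d → IsUnit (a (Sum.inl i) (Sum.inr j))

end Display

end

/-!
Let `⟨x, F^i x⟩` be the pairings of a vector `x ∈ M` with its images under `F`. The basis has
`X_i = F^(i-1) x` for a generator `x` of `M` modulo `FM + VM` with `⟨x, F^i x⟩ = 0` for `0 < i < d`
and `⟨x, F^d x⟩ = 1`.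

*Generators.* By duality the topological nilpotence of `V` gives that of `F`
(`exists_iterate_F_eq_smul_of_isFormal`). As `a(M) = 1`, the filtration `F^n M + VM` drops by length
one at each step until it reaches `VM`, at `n = d` (`IsGenerator.filtration_eq_range_V_iff`). Hence
`x, F x, …, F^(d-1) x` span `M` modulo `VM`, `F^d M ⊆ VM`, and `⟨x, F^d x⟩` is a unit
(`IsGenerator.isUnit_pairing_iterate_F`).

*Normalization.* By `⟨V^j x, F^i x⟩ = ⟨x, F^(i+j) x⟩^(σ^(-j))`, the vectors `V^(d-i) x` are dual modulo
`p` to the `F^i x`, up to a triangular matrix with unit diagonal. So the pairings with `0 < i < d` can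
be changed at will modulo `p` by adding to `x` combinations of the `V^j x`, and `⟨x, F^d x⟩` by
multiplying `x` by a scalar, which amounts to equations `c^(p^d + 1) = u` and `c^(p^d) + c = t` over
the algebraically closed field `k`. Successive approximation gives
`exists_isGenerator_pairing_iterate_F_eq`.

*The complement.* The span `L` of the `X_i` is isotropic, since `⟨F a, F b⟩ = p ⟨a, b⟩^σ`, and it has
a symplectic complement with basis `Y_j = V U_j ∈ VM`. In a symplectic basis, `F X_d - Y_1 ∈ L` and
`U_j - Y_(j+1) ∈ L` (`U_d ∈ L` for `j = d`) can be tested by pairing with the `X_i`; everything then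
holds automatically, except for `⟨X_1, U_j⟩ = 0`. This last condition is reached by adding to the
`Y_j` combinations of the `X_i` with coefficients in a symmetric matrix divisible by `p`
(`exists_symplectic_complement`). The family so obtained is a basis by Nakayama's lemma
(`span_sumElim_eq_top`).
-/

set_option linter.unusedSectionVars false

namespace Dieudonne

/-! ### Witt vectors modulo powers of `p` -/

section WittVectors

variable {p : ℕ} [Fact p.Prime] {k : Type*} [Field k] [CharP k p] [PerfectRing k p]

lemma p_dvd_iff {x : WittVector p k} : (p : WittVector p k) ∣ x ↔ x.coeff 0 = 0 := by
  rw [← Ideal.mem_span_singleton, WittVector.mem_span_p_iff_coeff_zero_eq_zero]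

lemma isUnit_of_not_p_dvd {x : WittVector p k} (h : ¬ (p : WittVector p k) ∣ x) : IsUnit x :=
  WittVector.isUnit_of_coeff_zero_ne_zero x (mt p_dvd_iff.2 h)

lemma not_p_dvd_one : ¬ (p : WittVector p k) ∣ 1 := by
  simp [p_dvd_iff]

lemma p_ne_zero : (p : WittVector p k) ≠ 0 :=
  (WittVector.irreducible p).ne_zero

lemma eq_zero_of_forall_pow_p_dvd {x : WittVector p k}
    (h : ∀ n : ℕ, (p : WittVector p k) ^ n ∣ x) : x = 0 := by
  ext n
  have := (WittVector.mem_span_p_pow_iff_le_coeff_eq_zero x (n + 1)).1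
    (Ideal.mem_span_singleton.2 (h (n + 1))) n n.lt_succ_self
  simpa using this

lemma p_dvd_sigma {x : WittVector p k} (h : (p : WittVector p k) ∣ x) :
    (p : WittVector p k) ∣ sigma p k x := by
  simpa using map_dvd (sigma p k) h

lemma p_dvd_tau {x : WittVector p k} (h : (p : WittVector p k) ∣ x) :
    (p : WittVector p k) ∣ tau p k x := by
  simpa using map_dvd (tau p k) h

lemma p_dvd_iterate_sigma {x : WittVector p k} (h : (p : WittVector p k) ∣ x) (n : ℕ) :
    (p : WittVector p k) ∣ (sigma p k)^[n] x := by
  induction n with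
  | zero => exact h
  | succ n ih => rw [Function.iterate_succ_apply']; exact p_dvd_sigma ih

lemma p_dvd_iterate_tau {x : WittVector p k} (h : (p : WittVector p k) ∣ x) (n : ℕ) :
    (p : WittVector p k) ∣ (tau p k)^[n] x := by
  induction n with
  | zero => exact h
  | succ n ih => rw [Function.iterate_succ_apply']; exact p_dvd_tau ih

lemma coeff_zero_iterate_sigma (x : WittVector p k) (n : ℕ) :
    ((sigma p k)^[n] x).coeff 0 = x.coeff 0 ^ p ^ n := by
  induction n with
  | zero => simp
  | succ n ih =>
    rw [Function.iterate_succ_apply', sigma, WittVector.coeff_frobenius_charP, ← sigma, ih,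
      ← pow_mul, ← pow_succ]

lemma exists_dvd_add_iterate_sigma_sub [IsAlgClosed k] {d : ℕ} (hd : d ≠ 0)
    (t : WittVector p k) : ∃ c, (p : WittVector p k) ∣ c + (sigma p k)^[d] c - t := by
  have hp : 1 < p ^ d := Nat.one_lt_pow hd (Fact.out : p.Prime).one_lt
  obtain ⟨a, ha⟩ := IsAlgClosed.exists_root
    (Polynomial.X ^ p ^ d + (Polynomial.X - Polynomial.C (t.coeff 0)) : Polynomial k) (by
      rw [Polynomial.degree_add_eq_left_of_degree_lt] <;>
        simp only [Polynomial.degree_X_pow, Polynomial.degree_X_sub_C]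
      · exact_mod_cast (by omega)
      · exact_mod_cast hp)
  refine ⟨WittVector.teichmuller p a, p_dvd_iff.2 ?_⟩
  have ha' : a ^ p ^ d + (a - t.coeff 0) = 0 := by simpa using ha
  have h := coeff_zero_iterate_sigma (WittVector.teichmuller p a) d
  rw [WittVector.teichmuller_coeff_zero] at h
  rw [← WittVector.constantCoeff_apply, map_sub, map_add]
  simp only [WittVector.constantCoeff_apply, h, WittVector.teichmuller_coeff_zero]
  linear_combination ha'

lemma exists_isUnit_dvd_mul_iterate_sigma_sub_one [IsAlgClosed k] (d : ℕ)
    {u : WittVector p k} (hu : IsUnit u) :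
    ∃ c, IsUnit c ∧ (p : WittVector p k) ∣ c * (sigma p k)^[d] c * u - 1 := by
  have hu0 : u.coeff 0 ≠ 0 := (hu.map (WittVector.constantCoeff : WittVector p k →+* k)).ne_zero
  obtain ⟨a, ha⟩ := IsAlgClosed.exists_pow_nat_eq (u.coeff 0)⁻¹ (n := p ^ d + 1) (by omega)
  have ha0 : a ≠ 0 := by
    rintro rfl
    rw [zero_pow (by omega)] at ha
    exact inv_ne_zero hu0 ha.symm
  have h := coeff_zero_iterate_sigma (WittVector.teichmuller p a) d
  rw [WittVector.teichmuller_coeff_zero] at h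
  refine ⟨WittVector.teichmuller p a, WittVector.isUnit_of_coeff_zero_ne_zero _ (by
    rwa [WittVector.teichmuller_coeff_zero]), p_dvd_iff.2 ?_⟩
  rw [← WittVector.constantCoeff_apply, map_sub, map_mul, map_mul, map_one]
  simp only [WittVector.constantCoeff_apply, h, WittVector.teichmuller_coeff_zero]
  rw [← pow_succ', ha, inv_mul_cancel₀ hu0, sub_self]

/-- Convergence of `p`-adic Cauchy sequences in a finite free `W`-module, read off coordinates. -/
lemma exists_forall_eq_add_pow_smul {M : Type*} [AddCommGroup M] [Module (WittVector p k) M]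
    [Module.Free (WittVector p k) M] [Module.Finite (WittVector p k) M] (x : ℕ → M)
    (hx : ∀ n, ∃ z, x (n + 1) = x n + (p : WittVector p k) ^ n • z) :
    ∃ L, ∀ n, ∃ z, L = x n + (p : WittVector p k) ^ n • z := by
  have hmn : ∀ n m, ∃ z, x (n + m) = x n + (p : WittVector p k) ^ n • z := by
    intro n m
    induction m with
    | zero => exact ⟨0, by simp⟩
    | succ m ih =>
      obtain ⟨z, hz⟩ := ih
      obtain ⟨w, hw⟩ := hx (n + m)
      exact ⟨z + (p : WittVector p k) ^ m • w, by
        rw [← add_assoc, hw, hz, smul_add, smul_smul, ← pow_add, add_assoc]⟩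
  let b := Module.Free.chooseBasis (WittVector p k) M
  have key : ∀ i, ∃ l : WittVector p k, ∀ n, (p : WittVector p k) ^ n ∣ l - b.repr (x n) i := by
    intro i
    have hc : IsPrecomplete (Ideal.span {(p : WittVector p k)}) (WittVector p k) := inferInstance
    obtain ⟨l, hl⟩ := hc.prec (f := fun n => b.repr (x n) i) (by
      intro m n hmn'
      obtain ⟨c, rfl⟩ := Nat.exists_eq_add_of_le hmn'
      obtain ⟨z, hz⟩ := hmn m c
      simp only [Ideal.span_singleton_pow, smul_eq_mul, Ideal.mul_top, SModEq.sub_mem,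
        Ideal.mem_span_singleton]
      exact ⟨-b.repr z i, by simp [hz]⟩)
    refine ⟨l, fun n => ?_⟩
    have := (hl n).symm
    simpa only [Ideal.span_singleton_pow, smul_eq_mul, Ideal.mul_top, SModEq.sub_mem,
      Ideal.mem_span_singleton] using this
  choose l hl using key
  choose q hq using hl
  refine ⟨∑ i, l i • b i, fun n => ⟨∑ i, q i n • b i, ?_⟩⟩
  conv_rhs => rw [← b.sum_repr (x n)]
  rw [Finset.smul_sum, ← Finset.sum_add_distrib]
  refine Finset.sum_congr rfl fun i _ => ?_
  rw [smul_smul, ← hq, ← add_smul]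
  congr 1
  ring

end WittVectors

end Dieudonne

namespace DieudonneModule

open Dieudonne

variable {p : ℕ} [Fact p.Prime] {k : Type*} [Field k] [CharP k p] [PerfectRing k p]
  {M : Type*} [AddCommGroup M] [Module (WittVector p k) M] {D : DieudonneModule p k M}

/-! ### Iterates of `F` and `V` -/

lemma iterate_F_add (n : ℕ) (x y : M) : D.F^[n] (x + y) = D.F^[n] x + D.F^[n] y :=
  iterate_map_add D.F n x y

lemma iterate_F_smul (n : ℕ) (c : WittVector p k) (x : M) :
    D.F^[n] (c • x) = (sigma p k)^[n] c • D.F^[n] x := by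
  induction n with
  | zero => rfl
  | succ n ih => simp only [Function.iterate_succ_apply', ih, LinearMap.map_smulₛₗ]

lemma iterate_F_p_pow_smul (n m : ℕ) (x : M) :
    D.F^[n] ((p : WittVector p k) ^ m • x) = (p : WittVector p k) ^ m • D.F^[n] x := by
  rw [iterate_F_smul, iterate_map_pow]
  congr 2
  exact Function.iterate_fixed (map_natCast _ _) n

lemma smul_p_mem_range_V (x : M) : (p : WittVector p k) • x ∈ LinearMap.range D.V :=
  ⟨D.F x, D.V_F x⟩

lemma exists_iterate_F_eq_smul {x : M} (hx : x ∈ LinearMap.range D.V) {n : ℕ} (hn : n ≠ 0) :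
    ∃ z, D.F^[n] x = (p : WittVector p k) • z := by
  obtain ⟨m, rfl⟩ := Nat.exists_eq_succ_of_ne_zero hn
  obtain ⟨y, rfl⟩ := hx
  refine ⟨D.F^[m] y, ?_⟩
  rw [Nat.succ_eq_add_one, Function.iterate_succ_apply, D.F_V]
  simpa using iterate_F_p_pow_smul (D := D) m 1 y

lemma F_injective [Module.Free (WittVector p k) M] : Function.Injective D.F := by
  intro x y h
  have h' : (p : WittVector p k) • x = (p : WittVector p k) • y := by
    rw [← D.V_F, ← D.V_F, h]
  exact smul_right_injective M p_ne_zero h'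

/-! ### The pairing -/

namespace PrincipalQuasiPolarization

variable (B : D.PrincipalQuasiPolarization)

lemma neg_pairing (x y : M) : - B.pairing x y = B.pairing y x :=
  LinearMap.IsAlt.neg B.alternating x y

lemma pairing_V (x y : M) : B.pairing (D.V x) y = tau p k (B.pairing x (D.F y)) := by
  rw [← B.neg_pairing (D.F y) x, B.F_V, map_neg, tau_sigma, B.neg_pairing]

lemma pairing_F_F (x y : M) :
    B.pairing (D.F x) (D.F y) = p * sigma p k (B.pairing x y) := by
  rw [B.F_V, D.V_F, map_smul, smul_eq_mul, map_mul, map_natCast]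

lemma pairing_iterate_F (n : ℕ) (x y : M) :
    B.pairing (D.F^[n] x) y = (sigma p k)^[n] (B.pairing x (D.V^[n] y)) := by
  induction n generalizing x y with
  | zero => rfl
  | succ n ih =>
    rw [Function.iterate_succ_apply, ih, B.F_V, ← Function.iterate_succ_apply,
      ← Function.iterate_succ_apply' D.V]

lemma pairing_iterate_V (n : ℕ) (x y : M) :
    B.pairing (D.V^[n] x) y = (tau p k)^[n] (B.pairing x (D.F^[n] y)) := by
  induction n generalizing x y with
  | zero => rfl
  | succ n ih =>
    rw [Function.iterate_succ_apply, ih, B.pairing_V, ← Function.iterate_succ_apply,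
      ← Function.iterate_succ_apply' D.F]

lemma pairing_iterate_F_iterate_F (n i j : ℕ) (x y : M) :
    B.pairing (D.F^[i + n] x) (D.F^[j + n] y) =
      (p : WittVector p k) ^ n * (sigma p k)^[n] (B.pairing (D.F^[i] x) (D.F^[j] y)) := by
  induction n with
  | zero => simp
  | succ n ih =>
    rw [← add_assoc, ← add_assoc, Function.iterate_succ_apply', Function.iterate_succ_apply',
      B.pairing_F_F, ih, map_mul, map_pow, map_natCast, ← mul_assoc, ← pow_succ',
      Function.iterate_succ_apply']

/-- The image of `V` is isotropic modulo `p`. -/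
lemma p_dvd_pairing_of_mem_range_V {x y : M} (hx : x ∈ LinearMap.range D.V)
    (hy : y ∈ LinearMap.range D.V) : (p : WittVector p k) ∣ B.pairing x y := by
  obtain ⟨x, rfl⟩ := hx
  obtain ⟨y, rfl⟩ := hy
  rw [B.pairing_V, D.F_V, map_smul, smul_eq_mul]
  exact p_dvd_tau (dvd_mul_right _ _)

/-- Perfectness of the pairing modulo `p`. -/
lemma exists_eq_smul_of_forall_p_dvd [Module.Free (WittVector p k) M] {x : M}
    (h : ∀ y, (p : WittVector p k) ∣ B.pairing x y) : ∃ z, x = (p : WittVector p k) • z := by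
  -- the functional `⟨x, ·⟩ / p` is represented by some `z`
  let b := Module.Free.chooseBasis (WittVector p k) M
  choose q hq using fun i => h (b i)
  have := B.perfect
  obtain ⟨z, hz⟩ := (LinearMap.IsPerfPair.bijective_left B.pairing).surjective
    (b.constr (WittVector p k) q)
  refine ⟨z, (LinearMap.IsPerfPair.bijective_left B.pairing).injective (b.ext fun i => ?_)⟩
  rw [map_smul, hz, hq, LinearMap.smul_apply, Module.Basis.constr_basis, smul_eq_mul]

/-- Duality turns the topological nilpotence of `V` into that of `F`. -/
lemma exists_iterate_F_eq_smul_of_isFormal (B : D.PrincipalQuasiPolarization)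
    [Module.Free (WittVector p k) M]
    (hformal : D.IsFormal) : ∃ n, ∀ x : M, ∃ z, D.F^[n] x = (p : WittVector p k) • z := by
  obtain ⟨n, hn⟩ := hformal
  refine ⟨n, fun x => B.exists_eq_smul_of_forall_p_dvd fun y => ?_⟩
  obtain ⟨z, hz⟩ := hn y
  rw [B.pairing_iterate_F, ← hz]
  refine p_dvd_iterate_sigma ?_ n
  simp

end PrincipalQuasiPolarization

end DieudonneModule

/-! ### Length of quotients along a chain of submodules -/

lemma Submodule.length_quotient_eq_add_one_of_covBy {R M : Type*} [Ring R] [AddCommGroup M]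
    [Module R M] {S T : Submodule R M} (h : S ⋖ T) :
    Module.length R (M ⧸ S) = Module.length R (M ⧸ T) + 1 := by
  have hs := (covBy_iff_quot_is_simple h.le).1 h
  have hlen := Module.length_eq_one_iff.2 hs
  have hex := Module.length_eq_add_of_exact
    (Submodule.mapQ (S.comap T.subtype) S T.subtype le_rfl) (Submodule.factor h.le) (by
      rw [← LinearMap.ker_eq_bot, Submodule.ker_mapQ, Submodule.mkQ_map_self])
    (Submodule.factor_surjective h.le) (by
      intro y
      obtain ⟨y, rfl⟩ := Submodule.Quotient.mk_surjective _ y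
      constructor
      · intro hy
        have hy' : y ∈ T := (Submodule.Quotient.mk_eq_zero T).1 hy
        exact ⟨Submodule.Quotient.mk ⟨y, hy'⟩, rfl⟩
      · rintro ⟨x, hx⟩
        obtain ⟨x, rfl⟩ := Submodule.Quotient.mk_surjective _ x
        rw [← hx]
        exact (Submodule.Quotient.mk_eq_zero T).2 x.2)
  rw [hex, hlen, add_comm]

namespace DieudonneModule

open Dieudonne

variable {p : ℕ} [Fact p.Prime] {k : Type*} [Field k] [CharP k p] [PerfectRing k p]
  {M : Type*} [AddCommGroup M] [Module (WittVector p k) M] {D : DieudonneModule p k M}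

/-- A submodule enlarged by one vector that `p` carries back into it grows by at most one simple
factor, since `W` is local with maximal ideal `pW`. -/
lemma covBy_of_eq_span_sup {S T : Submodule (WittVector p k) M} {x : M}
    (hT : T = Submodule.span (WittVector p k) {x} ⊔ S) (hne : S ≠ T)
    (hx : (p : WittVector p k) • x ∈ S) : S ⋖ T := by
  have hle : S ≤ T := hT ▸ le_sup_right
  refine ⟨lt_of_le_of_ne hle hne, fun N hSN hNT => ?_⟩
  obtain ⟨n, hnN, hnS⟩ := SetLike.exists_of_lt hSN
  have hnT := hNT.le hnN
  rw [hT] at hnT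
  obtain ⟨y, hy, s, hs, rfl⟩ := Submodule.mem_sup.1 hnT
  obtain ⟨c, rfl⟩ := Submodule.mem_span_singleton.1 hy
  have hc : IsUnit c := by
    refine isUnit_of_not_p_dvd ?_
    rintro ⟨b, rfl⟩
    refine hnS (S.add_mem ?_ hs)
    rw [mul_comm, mul_smul]
    exact S.smul_mem b hx
  have hxN : x ∈ N := by
    have := (N.add_mem_iff_left (hSN.le hs)).1 hnN
    exact (N.smul_mem_iff_of_isUnit hc).1 this
  refine absurd hNT (not_lt_of_ge ?_)
  rw [hT, sup_le_iff, Submodule.span_singleton_le_iff_mem]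
  exact ⟨hxN, hSN.le⟩

/-! ### Generators of a Dieudonné module with `a`-number one -/

variable (D) in
/-- `x` generates `M` modulo `FM + VM`; when `F` and `V` are topologically nilpotent this says
that `x` generates `M` over the Dieudonné ring. -/
def IsGenerator (x : M) : Prop :=
  Submodule.span (WittVector p k) {x} ⊔ (LinearMap.range D.F ⊔ LinearMap.range D.V) = ⊤

lemma exists_isGenerator (ha : D.aNumber = 1) : ∃ x, D.IsGenerator x := by
  have hs : IsSimpleModule (WittVector p k)
      (M ⧸ (LinearMap.range D.F ⊔ LinearMap.range D.V)) := Module.length_eq_one_iff.1 ha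
  have hco := isSimpleModule_iff_isCoatom.1 hs
  obtain ⟨x, -, hx⟩ := SetLike.exists_of_lt hco.lt_top
  refine ⟨x, hco.2 _ (lt_of_le_of_ne le_sup_right fun h => hx ?_)⟩
  rw [h]
  exact Submodule.mem_sup_left (Submodule.mem_span_singleton_self x)

lemma IsGenerator.of_eq_smul_add {x x' y : M} (hx : D.IsGenerator x) {c : WittVector p k}
    (hc : IsUnit c) (hy : y ∈ LinearMap.range D.V) (h : x' = c • x + y) : D.IsGenerator x' := by
  refine eq_top_iff.2 (hx.symm.le.trans (sup_le ?_ le_sup_right))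
  rw [Submodule.span_singleton_le_iff_mem, ← Submodule.smul_mem_iff_of_isUnit _ hc]
  rw [show c • x = x' - y by rw [h, add_sub_cancel_right]]
  exact Submodule.sub_mem _ (Submodule.mem_sup_left (Submodule.mem_span_singleton_self _))
    (Submodule.mem_sup_right (Submodule.mem_sup_right hy))

variable (D) in
/-- The descending filtration `F^n M + V M` of `M`. -/
noncomputable def filtration : ℕ → Submodule (WittVector p k) M
  | 0 => ⊤
  | n + 1 => (filtration n).map D.F ⊔ LinearMap.range D.V

lemma filtration_succ (n : ℕ) :
    D.filtration (n + 1) = (D.filtration n).map D.F ⊔ LinearMap.range D.V := rfl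

lemma range_V_le_filtration (n : ℕ) : LinearMap.range D.V ≤ D.filtration n := by
  cases n with
  | zero => exact le_top
  | succ n => exact le_sup_right

lemma exists_of_mem_filtration {n : ℕ} {x : M} (hx : x ∈ D.filtration n) :
    ∃ a b, x = D.F^[n] a + D.V b := by
  induction n generalizing x with
  | zero => exact ⟨x, 0, by simp⟩
  | succ n ih =>
    obtain ⟨_, ⟨y, hy, rfl⟩, _, ⟨c, rfl⟩, rfl⟩ := Submodule.mem_sup.1 hx
    obtain ⟨a, b, rfl⟩ := ih hy
    refine ⟨a, D.F b + c, ?_⟩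
    rw [map_add, D.F_V, map_add, D.V_F, Function.iterate_succ_apply', add_assoc]

lemma iterate_F_mem_filtration (n : ℕ) (x : M) : D.F^[n] x ∈ D.filtration n := by
  induction n with
  | zero => exact Submodule.mem_top
  | succ n ih =>
    rw [Function.iterate_succ_apply']
    exact Submodule.mem_sup_left (Submodule.mem_map_of_mem ih)

lemma IsGenerator.filtration_eq {x : M} (hx : D.IsGenerator x) (n : ℕ) :
    D.filtration n =
      Submodule.span (WittVector p k) {D.F^[n] x} ⊔ D.filtration (n + 1) := by
  induction n with
  | zero =>
    rw [filtration_succ]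
    change ⊤ = _ ⊔ (Submodule.map D.F ⊤ ⊔ _)
    rw [Submodule.map_top]
    exact hx.symm
  | succ n ih =>
    conv_lhs => rw [filtration_succ, ih]
    rw [Submodule.map_sup, Submodule.map_span, Set.image_singleton, sup_assoc,
      ← filtration_succ, Function.iterate_succ_apply']

lemma filtration_eq_of_succ_eq {n : ℕ} (h : D.filtration (n + 1) = D.filtration n) (m : ℕ) :
    D.filtration (n + m) = D.filtration n := by
  induction m with
  | zero => rfl
  | succ m ih => rw [← add_assoc, filtration_succ, ih, ← filtration_succ, h]

lemma exists_filtration_eq_range_V (hF : ∃ n, ∀ x : M, ∃ z, D.F^[n] x = (p : WittVector p k) • z) :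
    ∃ n, ∀ m ≥ n, D.filtration m = LinearMap.range D.V := by
  obtain ⟨n, hn⟩ := hF
  refine ⟨n, fun m hm => le_antisymm (fun x hx => ?_) (range_V_le_filtration m)⟩
  obtain ⟨a, b, rfl⟩ := exists_of_mem_filtration hx
  obtain ⟨c, rfl⟩ := Nat.exists_eq_add_of_le hm
  obtain ⟨z, hz⟩ := hn (D.F^[c] a)
  rw [Function.iterate_add_apply, hz]
  exact Submodule.add_mem _ (smul_p_mem_range_V z) ⟨b, rfl⟩

/-- The filtration `F^n M + V M` drops by length one at each step until it reaches `V M`, which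
therefore happens exactly at `n = d`. -/
lemma IsGenerator.filtration_eq_range_V_iff {x : M} (hx : D.IsGenerator x)
    (hF : ∃ n, ∀ x : M, ∃ z, D.F^[n] x = (p : WittVector p k) • z) {d : ℕ}
    (hd : D.dimension = (d : ℕ∞)) (n : ℕ) :
    D.filtration n = LinearMap.range D.V ↔ d ≤ n := by
  classical
  obtain ⟨N, hN⟩ := exists_filtration_eq_range_V hF
  have hex : ∃ m, D.filtration m = LinearMap.range D.V := ⟨N, hN N le_rfl⟩
  have hlen : ∀ i ≤ Nat.find hex,
      Module.length (WittVector p k) (M ⧸ D.filtration i) = (i : ℕ∞) := by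
    intro i
    induction i with
    | zero =>
      intro _
      rw [Nat.cast_zero, Module.length_eq_zero_iff, Submodule.Quotient.subsingleton_iff]
      rfl
    | succ i ih =>
      intro hi
      have hcov : D.filtration (i + 1) ⋖ D.filtration i := by
        refine covBy_of_eq_span_sup (hx.filtration_eq i) (fun h => ?_)
          (range_V_le_filtration _ (smul_p_mem_range_V _))
        refine Nat.find_min hex hi ?_
        rw [← filtration_eq_of_succ_eq h N]
        exact hN _ (Nat.le_add_left _ _)
      rw [Submodule.length_quotient_eq_add_one_of_covBy hcov, ih (Nat.le_of_succ_le hi)]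
      push_cast
      rfl
  have hfind : Nat.find hex = d := by
    have h := hlen _ le_rfl
    rw [Nat.find_spec hex] at h
    exact_mod_cast h.symm.trans hd
  constructor
  · intro h
    rw [← hfind]
    exact Nat.find_min' hex h
  · intro h
    obtain ⟨c, rfl⟩ := Nat.exists_eq_add_of_le h
    have hd' : D.filtration d = LinearMap.range D.V := hfind ▸ Nat.find_spec hex
    refine le_antisymm ?_ (range_V_le_filtration _)
    intro y hy
    obtain ⟨a, b, rfl⟩ := exists_of_mem_filtration hy
    rw [← hd', Function.iterate_add_apply]
    exact Submodule.add_mem _ (iterate_F_mem_filtration d _)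
      (range_V_le_filtration d ⟨b, rfl⟩)

section Consequences

variable {x : M} (hx : D.IsGenerator x)
  (hF : ∃ n, ∀ x : M, ∃ z, D.F^[n] x = (p : WittVector p k) • z) {d : ℕ}
  (hd : D.dimension = (d : ℕ∞))
include hx hF hd

lemma IsGenerator.iterate_F_mem_range_V {n : ℕ} (hn : d ≤ n) (y : M) :
    D.F^[n] y ∈ LinearMap.range D.V := by
  rw [← (hx.filtration_eq_range_V_iff hF hd n).2 hn]
  exact iterate_F_mem_filtration n y

lemma IsGenerator.iterate_F_not_mem_range_V {n : ℕ} (hn : n < d) :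
    D.F^[n] x ∉ LinearMap.range D.V := by
  intro h
  have hle : D.filtration n = D.filtration (n + 1) := by
    have := hx.filtration_eq n
    rwa [sup_eq_right.2] at this
    rw [Submodule.span_singleton_le_iff_mem]
    exact range_V_le_filtration _ h
  have hd' : D.filtration n = LinearMap.range D.V := by
    rw [← filtration_eq_of_succ_eq hle.symm d]
    exact (hx.filtration_eq_range_V_iff hF hd _).2 (Nat.le_add_left _ _)
  have := (hx.filtration_eq_range_V_iff hF hd n).1 hd'
  omega

lemma IsGenerator.span_sup_range_V :
    Submodule.span (WittVector p k) (Set.range fun i : Fin d => D.F^[(i : ℕ)] x) ⊔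
      LinearMap.range D.V = ⊤ := by
  have key : ∀ n ≤ d, Submodule.span (WittVector p k)
      (Set.range fun i : Fin d => D.F^[(i : ℕ)] x) ⊔ D.filtration n = ⊤ := by
    intro n
    induction n with
    | zero => intro _; exact sup_top_eq _
    | succ n ih =>
      intro hn
      rw [← ih (Nat.le_of_succ_le hn), hx.filtration_eq n, ← sup_assoc]
      congr 1
      rw [left_eq_sup, Submodule.span_singleton_le_iff_mem]
      exact Submodule.subset_span ⟨⟨n, hn⟩, rfl⟩
  rw [← (hx.filtration_eq_range_V_iff hF hd d).2 le_rfl]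
  exact key d le_rfl

end Consequences

/-! ### Normalizing the pairings `⟨x, F^i x⟩` -/

lemma dimension_ne_zero (ha : D.aNumber = 1) {d : ℕ} (hd : D.dimension = (d : ℕ∞)) : d ≠ 0 := by
  rintro rfl
  have h : LinearMap.range D.V = ⊤ := by
    rw [← Submodule.Quotient.subsingleton_iff, ← Module.length_eq_zero_iff (R := WittVector p k)]
    simpa [dimension] using hd
  have h' : D.aNumber = 0 := by
    rw [aNumber, Module.length_eq_zero_iff, Submodule.Quotient.subsingleton_iff, h, sup_top_eq]
  rw [h'] at ha
  exact zero_ne_one ha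

section

variable [Module.Free (WittVector p k) M]
  (B : D.PrincipalQuasiPolarization) {x : M} (hx : D.IsGenerator x)
  (hF : ∃ n, ∀ x : M, ∃ z, D.F^[n] x = (p : WittVector p k) • z) {d : ℕ}
  (hd : D.dimension = (d : ℕ∞))
include hx hF hd

/-- If `p` divided `⟨x, F^d x⟩`, then `F^d x` would pair into `pW` with all of `M`, so that
`F^d x ∈ pM = FVM` and `F^(d-1) x ∈ VM`. -/
lemma IsGenerator.isUnit_pairing_iterate_F (hd0 : d ≠ 0) :
    IsUnit (B.pairing x (D.F^[d] x)) := by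
  obtain ⟨e, rfl⟩ := Nat.exists_eq_succ_of_ne_zero hd0
  refine isUnit_of_not_p_dvd fun hdvd => ?_
  have hle : (⊤ : Submodule (WittVector p k) M) ≤
      Submodule.comap (B.pairing (D.F^[e + 1] x)) (Ideal.span {(p : WittVector p k)}) := by
    rw [← hx.span_sup_range_V hF hd, sup_le_iff, Submodule.span_le]
    constructor
    · rintro _ ⟨⟨i, hi⟩, rfl⟩
      refine Ideal.mem_span_singleton.2 ?_
      cases i with
      | zero =>
        rw [← B.neg_pairing, dvd_neg]
        exact hdvd
      | succ i =>
        simp only [Function.iterate_succ_apply', B.pairing_F_F]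
        exact dvd_mul_right _ _
    · intro y hy
      exact Ideal.mem_span_singleton.2 (B.p_dvd_pairing_of_mem_range_V
        (hx.iterate_F_mem_range_V hF hd le_rfl x) hy)
  obtain ⟨z, hz⟩ := B.exists_eq_smul_of_forall_p_dvd
    (fun y => Ideal.mem_span_singleton.1 (hle (Submodule.mem_top (x := y))))
  refine hx.iterate_F_not_mem_range_V hF hd (Nat.lt_succ_self e) ⟨z, ?_⟩
  refine F_injective (D := D) ?_
  rw [D.F_V, ← hz, Function.iterate_succ_apply']

lemma IsGenerator.p_dvd_pairing_iterate_F {m : ℕ} (hm : d < m) (y z : M) :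
    (p : WittVector p k) ∣ B.pairing y (D.F^[m] z) := by
  obtain ⟨n, rfl⟩ := Nat.exists_eq_succ_of_ne_zero (Nat.ne_of_gt (Nat.zero_lt_of_lt hm))
  obtain ⟨w, hw⟩ := exists_iterate_F_eq_smul (n := 1)
    (hx.iterate_F_mem_range_V hF hd (Nat.le_of_lt_succ hm) z) one_ne_zero
  rw [Function.iterate_one] at hw
  rw [Function.iterate_succ_apply', hw, map_smul]
  exact dvd_mul_right _ _

end

/-- First-order expansion of `⟨x, F^i x⟩` modulo `p` in a direction `y ∈ VM`; the remaining terms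
vanish because `F^i y ∈ FVM = pM`. -/
lemma p_dvd_pairing_add_sub (B : D.PrincipalQuasiPolarization) (x : M) {y : M}
    (hy : y ∈ LinearMap.range D.V) {i : ℕ} (hi : i ≠ 0) :
    (p : WittVector p k) ∣ B.pairing (x + y) (D.F^[i] (x + y)) -
      (B.pairing x (D.F^[i] x) + B.pairing y (D.F^[i] x)) := by
  obtain ⟨z, hz⟩ := exists_iterate_F_eq_smul hy hi
  refine ⟨B.pairing (x + y) z, ?_⟩
  rw [iterate_F_add, map_add, hz, map_smul, map_add, LinearMap.add_apply, smul_eq_mul]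
  ring

lemma smul_iterate_V_mem_range_V (c : WittVector p k) (x : M) {n : ℕ} (hn : n ≠ 0) :
    c • D.V^[n] x ∈ LinearMap.range D.V := by
  obtain ⟨m, rfl⟩ := Nat.exists_eq_succ_of_ne_zero hn
  rw [Function.iterate_succ_apply']
  exact Submodule.smul_mem _ _ ⟨_, rfl⟩

/-- The condition modulo `p ^ n` that `⟨x, F^i x⟩ = 0` for `0 < i < d` and `⟨x, F^d x⟩ = 1`. -/
def PrincipalQuasiPolarization.IsNormalizedMod (B : D.PrincipalQuasiPolarization) (d n : ℕ)
    (x : M) : Prop :=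
  ∀ i, i ≠ 0 → i ≤ d →
    (p : WittVector p k) ^ n ∣ B.pairing x (D.F^[i] x) - if i = d then 1 else 0

section

variable [IsAlgClosed k] [Module.Free (WittVector p k) M]
  (B : D.PrincipalQuasiPolarization)
  (hF : ∃ n, ∀ x : M, ∃ z, D.F^[n] x = (p : WittVector p k) • z) {d : ℕ}
  (hd : D.dimension = (d : ℕ∞))
include hF hd

/-- Scaling makes `⟨x, F^d x⟩ = 1` modulo `p`; then the `⟨x, F^i x⟩` for `i = d - 1, …, 1` are
killed in this order by adding multiples of `V^(d-i) x`, which affects only the pairings of index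
at most `i`. -/
lemma IsGenerator.exists_isNormalizedMod_one {x : M} (hx : D.IsGenerator x) (hd0 : d ≠ 0) :
    ∃ y, D.IsGenerator y ∧ B.IsNormalizedMod d 1 y := by
  have key : ∀ j < d, ∃ y, D.IsGenerator y ∧ ∀ i, d - j ≤ i → i ≤ d →
      (p : WittVector p k) ∣ B.pairing y (D.F^[i] y) - if i = d then 1 else 0 := by
    intro j
    induction j with
    | zero =>
      intro _
      obtain ⟨c, hc, hcd⟩ := exists_isUnit_dvd_mul_iterate_sigma_sub_one d
        (hx.isUnit_pairing_iterate_F B hF hd hd0)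
      refine ⟨c • x, hx.of_eq_smul_add hc (Submodule.zero_mem _) (add_zero _).symm, ?_⟩
      intro i hi hi'
      obtain rfl : i = d := le_antisymm hi' (by simpa using hi)
      rw [if_pos rfl, iterate_F_smul, map_smul, LinearMap.map_smul₂, smul_eq_mul, smul_eq_mul,
        ← mul_assoc, mul_comm ((sigma p k)^[i] c)]
      exact hcd
    | succ j ih =>
      intro hj
      obtain ⟨y, hy, hyn⟩ := ih (Nat.lt_of_succ_lt hj)
      set q := B.pairing y (D.F^[d - (j + 1)] y) with hq
      have hmem := smul_iterate_V_mem_range_V (D := D) (-q) y (Nat.succ_ne_zero j)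
      -- modulo `p` the pairing of index `i` changes by `-q ⟨y, F^(i+j+1) y⟩^(σ^(-j-1))`, which is
      -- `-q` for `i = d - j - 1` and vanishes for larger `i`
      refine ⟨y + -q • D.V^[j + 1] y,
        hy.of_eq_smul_add isUnit_one hmem (by rw [one_smul]), ?_⟩
      intro i hi hi'
      have h1 := p_dvd_pairing_add_sub B y hmem (i := i) (by omega)
      have h2 : B.pairing (-q • D.V^[j + 1] y) (D.F^[i] y) =
          -q * (tau p k)^[j + 1] (B.pairing y (D.F^[j + 1 + i] y)) := by
        rw [LinearMap.map_smul₂, B.pairing_iterate_V, ← Function.iterate_add_apply, smul_eq_mul]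
      rw [h2] at h1
      rcases Nat.eq_or_lt_of_le hi with rfl | hi
      · have h3 := p_dvd_iterate_tau (hyn d (by omega) le_rfl) (j + 1)
        rw [if_pos rfl, iterate_map_sub, iterate_map_one] at h3
        rw [show j + 1 + (d - (j + 1)) = d by omega, ← hq] at h1
        rw [if_neg (by omega)]
        convert h1.sub (h3.mul_left q) using 1
        ring
      · have h3 := p_dvd_iterate_tau
          (hy.p_dvd_pairing_iterate_F B hF hd (m := j + 1 + i) (by omega) y y) (j + 1)
        convert (h1.add (hyn i (by omega) hi')).sub (h3.mul_left q) using 1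
        ring
  obtain ⟨y, hy, hyn⟩ := key (d - 1) (by omega)
  exact ⟨y, hy, fun i hi hi' => by rw [pow_one]; exact hyn i (by omega) hi'⟩

/-- Modulo `p`, the vectors `V^(d-j) x` are dual to the `F^i x` for `0 < i, j < d`. -/
lemma IsGenerator.p_dvd_pairing_sum_sub {x : M} (hx : D.IsGenerator x)
    (hn : B.IsNormalizedMod d 1 x) (q : ℕ → WittVector p k) {i : ℕ} (hi : i ≠ 0) (hid : i ≤ d) :
    (p : WittVector p k) ∣
      B.pairing (∑ j ∈ Finset.Ico 1 d, q j • D.V^[d - j] x) (D.F^[i] x) -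
        if i = d then 0 else q i := by
  have hq : (if i = d then 0 else q i) = ∑ j ∈ Finset.Ico 1 d, if i = j then q j else 0 := by
    rw [Finset.sum_ite_eq]
    by_cases h : i = d
    · rw [if_pos h, if_neg (by simp [h])]
    · rw [if_neg h, if_pos (by simp only [Finset.mem_Ico]; omega)]
  rw [hq, map_sum, LinearMap.sum_apply, ← Finset.sum_sub_distrib]
  refine Finset.dvd_sum fun j hj => ?_
  rw [Finset.mem_Ico] at hj
  rw [LinearMap.map_smul₂, B.pairing_iterate_V, ← Function.iterate_add_apply, smul_eq_mul]
  by_cases hlt : d < d - j + i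
  · rw [if_neg (by omega), sub_zero]
    exact (p_dvd_iterate_tau (hx.p_dvd_pairing_iterate_F B hF hd hlt x x) _).mul_left _
  · have h := hn (d - j + i) (by omega) (by omega)
    rw [pow_one] at h
    replace h := p_dvd_iterate_tau h (d - j)
    rw [iterate_map_sub] at h
    by_cases hij : i = j
    · rw [if_pos (by omega), iterate_map_one] at h
      rw [if_pos hij]
      convert h.mul_left (q j) using 1
      ring
    · rw [if_neg (by omega), iterate_map_zero, sub_zero] at h
      rw [if_neg hij, sub_zero]
      exact h.mul_left _

/-- The successive approximation step from `p ^ (n + 1)` to `p ^ (n + 2)`. The correction is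
`p ^ (n + 1) (c x + ∑ j, q_j V^(d-j) x)`, in which `c + σ^d c` is prescribed modulo `p`; this is
where `k` needs to be algebraically closed. -/
lemma IsGenerator.exists_isNormalizedMod_succ {x : M} (hx : D.IsGenerator x) (hd0 : d ≠ 0) {n : ℕ}
    (hn : B.IsNormalizedMod d (n + 1) x) :
    ∃ z, D.IsGenerator (x + (p : WittVector p k) ^ (n + 1) • z) ∧
      B.IsNormalizedMod d (n + 2) (x + (p : WittVector p k) ^ (n + 1) • z) := by
  have hn1 : B.IsNormalizedMod d 1 x := fun i hi hid =>
    (pow_dvd_pow _ (by omega)).trans (hn i hi hid)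
  have hq : ∀ i, ∃ q, i ≠ 0 → i ≤ d → B.pairing x (D.F^[i] x) - (if i = d then 1 else 0) =
      (p : WittVector p k) ^ (n + 1) * q := by
    intro i
    by_cases h : i ≠ 0 ∧ i ≤ d
    · obtain ⟨q, hq⟩ := hn i h.1 h.2
      exact ⟨q, fun _ _ => hq⟩
    · exact ⟨0, fun h1 h2 => absurd ⟨h1, h2⟩ h⟩
  choose q hq using hq
  obtain ⟨c, hc⟩ := exists_dvd_add_iterate_sigma_sub hd0 (-q d)
  set y := ∑ j ∈ Finset.Ico 1 d, (-q j) • D.V^[d - j] x with hy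
  have hyV : y ∈ LinearMap.range D.V := Submodule.sum_mem _ fun j hj =>
    smul_iterate_V_mem_range_V _ _ (by rw [Finset.mem_Ico] at hj; omega)
  refine ⟨c • x + y, hx.of_eq_smul_add isUnit_one (y := (p : WittVector p k) ^ (n + 1) •
    (c • x + y)) ?_ (by rw [one_smul]), ?_⟩
  · rw [pow_succ', mul_smul]
    exact smul_p_mem_range_V _
  intro i hi hid
  have h1 := hx.p_dvd_pairing_sum_sub B hF hd hn1 (fun j => -q j) hi hid
  rw [← hy] at h1
  obtain ⟨z, hz⟩ := exists_iterate_F_eq_smul hyV hi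
  have hexp : B.pairing (x + (p : WittVector p k) ^ (n + 1) • (c • x + y))
      (D.F^[i] (x + (p : WittVector p k) ^ (n + 1) • (c • x + y))) -
        (if i = d then 1 else 0) = (p : WittVector p k) ^ (n + 1) *
      (q i + (c + (sigma p k)^[i] c) * B.pairing x (D.F^[i] x) + B.pairing y (D.F^[i] x) +
        p * (B.pairing x z + p ^ n * B.pairing (c • x + y) (D.F^[i] (c • x + y)))) := by
    have h := hq i hi hid
    rw [iterate_F_add, iterate_F_p_pow_smul]
    simp only [map_add, LinearMap.add_apply, map_smul, LinearMap.smul_apply, smul_eq_mul,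
      iterate_F_add, iterate_F_smul, hz]
    linear_combination h
  rw [hexp, pow_succ _ (n + 1)]
  refine mul_dvd_mul_left _ (dvd_add ?_ (dvd_mul_right _ _))
  have h2 := hn1 i hi hid
  rw [pow_one] at h2
  by_cases h : i = d
  · subst h
    rw [if_pos rfl] at h1 h2
    convert (h1.add hc).add (h2.mul_left (c + (sigma p k)^[i] c)) using 1
    ring
  · rw [if_neg h] at h1 h2
    convert h1.add (h2.mul_left (c + (sigma p k)^[i] c)) using 1
    ring

/-- The normalization of the generator, `p`-adic limit of the successive approximations. -/
lemma exists_isGenerator_pairing_iterate_F_eq [Module.Finite (WittVector p k) M]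
    (ha : D.aNumber = 1) :
    ∃ x, D.IsGenerator x ∧
      ∀ i, i ≠ 0 → i ≤ d → B.pairing x (D.F^[i] x) = if i = d then 1 else 0 := by
  have hd0 := dimension_ne_zero ha hd
  obtain ⟨x₁, hx₁⟩ := exists_isGenerator ha
  obtain ⟨x₀, hx₀, hn₀⟩ := hx₁.exists_isNormalizedMod_one B hF hd hd0
  have hstep : ∀ (n : ℕ) (x : M), ∃ z, D.IsGenerator x ∧ B.IsNormalizedMod d (n + 1) x →
      D.IsGenerator (x + (p : WittVector p k) ^ (n + 1) • z) ∧
        B.IsNormalizedMod d (n + 2) (x + (p : WittVector p k) ^ (n + 1) • z) := by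
    intro n x
    by_cases h : D.IsGenerator x ∧ B.IsNormalizedMod d (n + 1) x
    · obtain ⟨z, hz⟩ := h.1.exists_isNormalizedMod_succ B hF hd hd0 h.2
      exact ⟨z, fun _ => hz⟩
    · exact ⟨0, fun h' => absurd h' h⟩
  -- `next` is a total function, so that the sequence of approximations is a plain recursion
  choose next hnext using hstep
  let u : ℕ → M := fun n => Nat.rec x₀ (fun n x => x + (p : WittVector p k) ^ (n + 1) • next n x) n
  have hu : ∀ n, u (n + 1) = u n + (p : WittVector p k) ^ (n + 1) • next n (u n) := fun _ => rfl
  have hun : ∀ n, D.IsGenerator (u n) ∧ B.IsNormalizedMod d (n + 1) (u n) := by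
    intro n
    induction n with
    | zero => exact ⟨hx₀, hn₀⟩
    | succ n ih =>
      rw [hu]
      exact hnext n (u n) ih
  obtain ⟨x, hx⟩ := exists_forall_eq_add_pow_smul u fun n =>
    ⟨(p : WittVector p k) • next n (u n), by rw [hu, pow_succ, mul_smul]⟩
  refine ⟨x, ?_, fun i hi hid => sub_eq_zero.1 (eq_zero_of_forall_pow_p_dvd fun n => ?_)⟩
  · obtain ⟨z, hz⟩ := hx 1
    rw [pow_one] at hz
    exact (hun 1).1.of_eq_smul_add isUnit_one (smul_p_mem_range_V z) (by rw [one_smul, hz])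
  · obtain ⟨z, hz⟩ := hx n
    have h1 := (pow_dvd_pow _ (Nat.le_succ n)).trans ((hun n).2 i hi hid)
    have h2 : B.pairing x (D.F^[i] x) = B.pairing (u n) (D.F^[i] (u n)) +
        (p : WittVector p k) ^ n * (B.pairing z (D.F^[i] x) + B.pairing (u n) (D.F^[i] z)) := by
      conv_lhs => rw [hz, map_add, LinearMap.add_apply, ← hz]
      conv_lhs => rw [LinearMap.map_smul₂, hz, iterate_F_add, iterate_F_p_pow_smul, map_add,
        map_smul, ← iterate_F_p_pow_smul, ← iterate_F_add, ← hz]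
      simp only [smul_eq_mul]
      ring
    rw [h2, add_sub_right_comm]
    exact h1.add (dvd_mul_right _ _)

end

/-! ### Symplectic families -/

namespace PrincipalQuasiPolarization

variable (B : D.PrincipalQuasiPolarization) {d : ℕ} {X Y : Fin d → M}

lemma pairing_add_sum_right (hX : ∀ i j, B.pairing (X i) (X j) = 0)
    (hXY : ∀ i j, B.pairing (X i) (Y j) = if i = j then 1 else 0)
    (T : Fin d → Fin d → WittVector p k) (i j : Fin d) :
    B.pairing (X i) (Y j + ∑ l, T l j • X l) = if i = j then 1 else 0 := by
  simp [hX, hXY]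

lemma pairing_add_sum_add_sum (hX : ∀ i j, B.pairing (X i) (X j) = 0)
    (hXY : ∀ i j, B.pairing (X i) (Y j) = if i = j then 1 else 0)
    (T : Fin d → Fin d → WittVector p k) (i j : Fin d) :
    B.pairing (Y i + ∑ l, T l i • X l) (Y j + ∑ l, T l j • X l) =
      B.pairing (Y i) (Y j) - T i j + T j i := by
  have hYX : ∀ i j, B.pairing (Y i) (X j) = -if i = j then 1 else 0 := fun i j => by
    rw [← B.neg_pairing, hXY]
    simp only [eq_comm]
  simp [hX, hXY, hYX, sub_eq_add_neg]

/-- A family in `VM` dual to an isotropic family can be made isotropic inside `VM`, since its Gram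
matrix is divisible by `p` and `pM ⊆ VM`. -/
lemma exists_isotropic_dual_in_range_V (hX : ∀ i j, B.pairing (X i) (X j) = 0)
    (hXY : ∀ i j, B.pairing (X i) (Y j) = if i = j then 1 else 0)
    (hY : ∀ j, Y j ∈ LinearMap.range D.V) :
    ∃ Y' : Fin d → M, (∀ j, Y' j ∈ LinearMap.range D.V) ∧
      (∀ i j, B.pairing (X i) (Y' j) = if i = j then 1 else 0) ∧
      ∀ i j, B.pairing (Y' i) (Y' j) = 0 := by
  let T : Fin d → Fin d → WittVector p k := fun i j =>
    if i < j then B.pairing (Y i) (Y j) else 0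
  refine ⟨fun j => Y j + ∑ l, T l j • X l, fun j => ?_, B.pairing_add_sum_right hX hXY T, ?_⟩
  · refine Submodule.add_mem _ (hY j) (Submodule.sum_mem _ fun l _ => ?_)
    by_cases h : l < j
    · obtain ⟨c, hc⟩ := B.p_dvd_pairing_of_mem_range_V (hY l) (hY j)
      simp only [T, if_pos h, hc, mul_smul]
      exact smul_p_mem_range_V _
    · simp only [T, if_neg h, zero_smul]
      exact Submodule.zero_mem _
  · intro i j
    rw [B.pairing_add_sum_add_sum hX hXY]
    rcases lt_trichotomy i j with h | rfl | h
    · simp [T, h, h.not_gt]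
    · simp [T, B.alternating]
    · simp only [T, h, h.not_gt, if_true, if_false, ← B.neg_pairing (Y i) (Y j)]
      ring

lemma linearIndependent_sumElim (hX : ∀ i j, B.pairing (X i) (X j) = 0)
    (hXY : ∀ i j, B.pairing (X i) (Y j) = if i = j then 1 else 0)
    (hY : ∀ i j, B.pairing (Y i) (Y j) = 0) :
    LinearIndependent (WittVector p k) (Sum.elim X Y) := by
  rw [Fintype.linearIndependent_iff]
  intro g hg
  rw [Fintype.sum_sum_type] at hg
  simp only [Sum.elim_inl, Sum.elim_inr] at hg
  rintro (i | i)
  · have h := congrArg (fun m => B.pairing m (Y i)) hg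
    simpa [hXY, hY] using h
  · have h := congrArg (fun m => B.pairing (X i) m) hg
    simpa [hXY, hX] using h

/-- A vector orthogonal to a symplectic family that generates `M` modulo `VM` lies in `pM`; the
family spans `M` by Nakayama's lemma. -/
lemma span_sumElim_eq_top [Module.Free (WittVector p k) M] [Module.Finite (WittVector p k) M]
    (hX : ∀ i j, B.pairing (X i) (X j) = 0)
    (hXY : ∀ i j, B.pairing (X i) (Y j) = if i = j then 1 else 0)
    (hY : ∀ i j, B.pairing (Y i) (Y j) = 0) (hYV : ∀ j, Y j ∈ LinearMap.range D.V)
    (hspan : Submodule.span (WittVector p k) (Set.range X) ⊔ LinearMap.range D.V = ⊤) :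
    Submodule.span (WittVector p k) (Set.range (Sum.elim X Y)) = ⊤ := by
  have hYX : ∀ i j, B.pairing (Y i) (X j) = -if i = j then 1 else 0 := fun i j => by
    rw [← B.neg_pairing, hXY]
    simp only [eq_comm]
  have key : ∀ m, (∀ i, B.pairing m (X i) = 0) → (∀ i, B.pairing m (Y i) = 0) →
      ∃ z, m = (p : WittVector p k) • z := by
    intro m hmX hmY
    obtain ⟨l, hl, v, hv, rfl⟩ := Submodule.mem_sup.1 (hspan.ge (Submodule.mem_top (x := m)))
    obtain ⟨c, rfl⟩ := (Submodule.mem_span_range_iff_exists_fun _).1 hl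
    have hc : ∀ i, (p : WittVector p k) ∣ c i := by
      intro i
      have h : c i + B.pairing v (Y i) = 0 := by simpa [hXY] using hmY i
      rw [eq_neg_of_add_eq_zero_left h, dvd_neg]
      exact B.p_dvd_pairing_of_mem_range_V hv (hYV i)
    have hmem : ∑ i, c i • X i + v ∈ LinearMap.range D.V := by
      refine Submodule.add_mem _ (Submodule.sum_mem _ fun i _ => ?_) hv
      obtain ⟨b, hb⟩ := hc i
      rw [hb, mul_smul]
      exact smul_p_mem_range_V _
    have hle : (⊤ : Submodule (WittVector p k) M) ≤
        Submodule.comap (B.pairing (∑ i, c i • X i + v))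
          (Ideal.span {(p : WittVector p k)}) := by
      rw [← hspan, sup_le_iff, Submodule.span_le]
      constructor
      · rintro _ ⟨i, rfl⟩
        rw [SetLike.mem_coe, Submodule.mem_comap, hmX]
        exact Submodule.zero_mem _
      · intro y hy
        exact Ideal.mem_span_singleton.2 (B.p_dvd_pairing_of_mem_range_V hmem hy)
    exact B.exists_eq_smul_of_forall_p_dvd fun y =>
      Ideal.mem_span_singleton.1 (hle (Submodule.mem_top (x := y)))
  refine top_le_iff.1 (Submodule.le_of_le_smul_of_le_jacobson_bot
    (I := Ideal.span {(p : WittVector p k)}) Module.Finite.fg_top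
    (IsAdicComplete.le_jacobson_bot _) fun m _ => ?_)
  obtain ⟨z, hz⟩ := key
    (m - ∑ i, (B.pairing m (Y i) • X i - B.pairing m (X i) • Y i))
    (fun i => by simp [hX, hYX]) (fun i => by simp [hXY, hY])
  rw [sub_eq_iff_eq_add'] at hz
  rw [hz]
  refine Submodule.add_mem_sup (Submodule.sum_mem _ fun i _ => ?_)
    (Submodule.smul_mem_smul (Ideal.mem_span_singleton_self _) Submodule.mem_top)
  exact Submodule.sub_mem _
    (Submodule.smul_mem _ _ (Submodule.subset_span ⟨Sum.inl i, rfl⟩))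
    (Submodule.smul_mem _ _ (Submodule.subset_span ⟨Sum.inr i, rfl⟩))

lemma IsSymplectic.repr_inr {B : D.PrincipalQuasiPolarization}
    {e : Module.Basis (Fin d ⊕ Fin d) (WittVector p k) M} (he : B.IsSymplectic e) (m : M)
    (i : Fin d) : e.repr m (Sum.inr i) = B.pairing (e (Sum.inl i)) m := by
  conv_rhs => rw [← e.sum_repr m, map_sum, Fintype.sum_sum_type]
  simp only [map_smul, he.1, he.2.1]
  simp

end PrincipalQuasiPolarization

/-! ### The symplectic basis attached to a normalized generator -/

section

variable (B : D.PrincipalQuasiPolarization) {d : ℕ} {x : M}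
  (hx : ∀ i, i ≠ 0 → i ≤ d → B.pairing x (D.F^[i] x) = if i = d then 1 else 0)
include hx

lemma pairing_iterate_F_eq_zero (i j : Fin d) :
    B.pairing (D.F^[(i : ℕ)] x) (D.F^[(j : ℕ)] x) = 0 := by
  wlog h : i ≤ j generalizing i j
  · rw [← B.neg_pairing, this j i (le_of_not_ge h), neg_zero]
  obtain ⟨c, hc⟩ := Nat.exists_eq_add_of_le' (Fin.le_def.1 h)
  have h0 : B.pairing (D.F^[0] x) (D.F^[c] x) = 0 := by
    rcases Nat.eq_zero_or_pos c with rfl | hc0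
    · exact B.alternating _
    · have := j.2
      exact (hx c hc0.ne' (by omega)).trans (if_neg (by omega))
  have := B.pairing_iterate_F_iterate_F (i : ℕ) 0 c x x
  rw [zero_add, ← hc, h0, iterate_map_zero, mul_zero] at this
  exact this

lemma pairing_iterate_F_iterate_F_dim (i : Fin d) :
    B.pairing (D.F^[(i : ℕ)] x) (D.F^[d] x) = if (i : ℕ) = 0 then 1 else 0 := by
  have hi := i.2
  have := B.pairing_iterate_F_iterate_F (i : ℕ) 0 (d - i) x x
  rw [zero_add, Nat.sub_add_cancel hi.le, Function.iterate_zero, id_eq,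
    hx _ (by omega) (by omega)] at this
  rw [this]
  by_cases h : (i : ℕ) = 0
  · simp [h]
  · rw [if_neg (by omega), if_neg h, iterate_map_zero, mul_zero]

/-- The vectors `-V^(d-j) x` are dual to the `F^i x` up to a unitriangular matrix. -/
lemma exists_dual_in_range_V : ∃ Y : Fin d → M, (∀ j, Y j ∈ LinearMap.range D.V) ∧
    ∀ i j : Fin d, B.pairing (D.F^[(i : ℕ)] x) (Y j) = if i = j then 1 else 0 := by
  let Z : Fin d → M := fun j => (-1 : WittVector p k) • D.V^[d - j] x
  let G : Matrix (Fin d) (Fin d) (WittVector p k) :=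
    Matrix.of fun i j => B.pairing (D.F^[(i : ℕ)] x) (Z j)
  have hG : ∀ i j : Fin d, G i j = (tau p k)^[d - j] (B.pairing x (D.F^[d - j + i] x)) := by
    intro i j
    simp only [G, Z, Matrix.of_apply, map_smul, smul_eq_mul, neg_mul, one_mul]
    rw [B.neg_pairing, B.pairing_iterate_V, ← Function.iterate_add_apply]
  have hdet : IsUnit G.det := by
    rw [Matrix.det_of_isLowerTriangular G]
    · rw [Finset.prod_eq_one]
      · exact isUnit_one
      · intro i _
        have := i.2
        rw [hG, hx _ (by omega) (by omega), if_pos (by omega), iterate_map_one]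
    · intro i j hij
      have hij' : (i : ℕ) < j := hij
      have := j.2
      rw [hG, hx _ (by omega) (by omega), if_neg (by omega), iterate_map_zero]
  refine ⟨fun j => ∑ l, G⁻¹ l j • Z l, fun j => Submodule.sum_mem _ fun l _ =>
    Submodule.smul_mem _ _ (smul_iterate_V_mem_range_V _ _ (by have := l.2; omega)), ?_⟩
  intro i j
  have h := congrFun (congrFun (Matrix.mul_nonsing_inv G hdet) i) j
  rw [Matrix.one_apply, Matrix.mul_apply] at h
  rw [← h, map_sum]
  exact Finset.sum_congr rfl fun l _ => by rw [map_smul, smul_eq_mul, mul_comm]; rfl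

/-- A symplectic complement `Y_j = V U_j` of the span of the `F^i x`, with `⟨x, U_j⟩ = 0`. The last
condition is met by adding to the `Y_j` combinations of the `F^i x` with coefficients in a matrix
`p S`; since `⟨x, F (F^i x)⟩` vanishes for `i < d - 1`, only the last row of `S` matters, so that
`S` can be chosen symmetric, which keeps the `Y_j` isotropic. -/
lemma exists_symplectic_complement : ∃ U : Fin d → M,
    (∀ i j : Fin d, B.pairing (D.F^[(i : ℕ)] x) (D.V (U j)) = if i = j then 1 else 0) ∧
    (∀ i j, B.pairing (D.V (U i)) (D.V (U j)) = 0) ∧ ∀ j, B.pairing x (U j) = 0 := by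
  obtain ⟨Y₀, hYV₀, hXY₀⟩ := exists_dual_in_range_V B hx
  have hX := pairing_iterate_F_eq_zero B hx
  obtain ⟨Y, hYV, hXY, hY⟩ := B.exists_isotropic_dual_in_range_V hX hXY₀ hYV₀
  choose U hU using hYV
  let s : Fin d → WittVector p k := fun j => -tau p k (B.pairing x (U j))
  let S : Fin d → Fin d → WittVector p k := fun l j =>
    if (l : ℕ) + 1 = d then s j else if (j : ℕ) + 1 = d then s l else 0
  have hS : ∀ i j, S i j = S j i := by
    intro i j
    simp only [S]
    by_cases hi : (i : ℕ) + 1 = d <;> by_cases hj : (j : ℕ) + 1 = d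
    · rw [if_pos hi, if_pos hj, Fin.ext (show (i : ℕ) = j by omega)]
    · rw [if_pos hi, if_neg hj, if_pos hi]
    · rw [if_neg hi, if_pos hj, if_pos hj]
    · rw [if_neg hi, if_neg hj, if_neg hj, if_neg hi]
  have hV : ∀ j, D.V (U j + ∑ l, sigma p k (S l j) • D.F (D.F^[(l : ℕ)] x)) =
      Y j + ∑ l, ((p : WittVector p k) * S l j) • D.F^[(l : ℕ)] x := by
    intro j
    rw [map_add, hU, map_sum]
    simp only [LinearMap.map_smulₛₗ, tau_sigma, D.V_F, smul_smul, mul_comm]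
  refine ⟨fun j => U j + ∑ l, sigma p k (S l j) • D.F (D.F^[(l : ℕ)] x), ?_, ?_, ?_⟩
  · intro i j
    rw [hV]
    exact B.pairing_add_sum_right hX hXY (fun l j => (p : WittVector p k) * S l j) i j
  · intro i j
    rw [hV, hV]
    refine (B.pairing_add_sum_add_sum hX hXY (fun l j => (p : WittVector p k) * S l j) i j).trans ?_
    rw [hY, hS i j]
    ring
  · intro j
    have hd0 : d - 1 < d := by have := j.2; omega
    rw [map_add, map_sum, Finset.sum_eq_single_of_mem ⟨d - 1, hd0⟩ (Finset.mem_univ _)]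
    · rw [map_smul, ← Function.iterate_succ_apply' D.F, hx _ (by omega) (by omega),
        if_pos (by simp only; omega)]
      simp only [S]
      rw [if_pos (by omega)]
      simp [s]
    · intro l _ hl
      have hl' : (l : ℕ) + 1 ≠ d := fun h => hl (Fin.ext (by simp only; omega))
      have := l.2
      rw [map_smul, ← Function.iterate_succ_apply' D.F, hx _ (by omega) (by omega),
        if_neg (by omega), smul_zero]

end

/-! ### The display matrix -/

/-- The matrix with columns the coordinates of `F X_j` and of the `U_j`. It displays `M` when
`Y_j = V U_j`, that is, `U_j = V⁻¹ Y_j`. -/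
noncomputable def displayMatrix (D : DieudonneModule p k M) {d c : ℕ}
    (e : Module.Basis (Fin d ⊕ Fin c) (WittVector p k) M) (U : Fin c → M) :
    Matrix (Fin d ⊕ Fin c) (Fin d ⊕ Fin c) (WittVector p k) :=
  Matrix.of fun i j => Sum.elim (fun j => e.repr (D.F (e (Sum.inl j))) i)
    (fun j => e.repr (U j) i) j

section

variable {d c : ℕ} {e : Module.Basis (Fin d ⊕ Fin c) (WittVector p k) M} {U : Fin c → M}
  (hU : ∀ j, e (Sum.inr j) = D.V (U j))
include hU

lemma isDisplayedBy_displayMatrix : D.IsDisplayedBy e (D.displayMatrix e U) := by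
  refine ⟨fun j => ?_, fun j => ?_⟩
  · exact (e.sum_repr _).symm
  · rw [hU]
    exact congrArg D.V (e.sum_repr _).symm

lemma FMatrix_eq_toFMatrix_displayMatrix :
    D.FMatrix e = Display.toFMatrix p (D.displayMatrix e U) := by
  ext i j
  rcases j with j | j
  · rcases i with i | i <;> rfl
  · have h : D.F (e (Sum.inr j)) = (p : WittVector p k) • U j := by rw [hU, D.F_V]
    rcases i with i | i <;>
      simp [FMatrix, Display.toFMatrix, displayMatrix, h, Matrix.toBlocks₁₂, Matrix.toBlocks₂₂]

end

section

variable {B : D.PrincipalQuasiPolarization} {d : ℕ}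
  {e : Module.Basis (Fin d ⊕ Fin d) (WittVector p k) M} (he : B.IsSymplectic e)
  {x : M} {U : Fin d → M} (hX : ∀ i : Fin d, e (Sum.inl i) = D.F^[(i : ℕ)] x)
  (hU : ∀ j, e (Sum.inr j) = D.V (U j)) (hxU : ∀ j, B.pairing x (U j) = 0)
include he hX hU hxU

/-- The coordinates of `U_j` along the `Y_i` are those of `Y_{j+1}`: for `i > 0` they are given by
`⟨F X_{i-1}, U_j⟩ = ⟨X_{i-1}, Y_j⟩^σ`, and for `i = 0` they vanish by the choice of the `U_j`. -/
lemma repr_inr_eq (i j : Fin d) :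
    e.repr (U j) (Sum.inr i) = if (i : ℕ) = j + 1 then 1 else 0 := by
  rw [he.repr_inr, hX]
  obtain ⟨i, hi⟩ := i
  cases i with
  | zero => simpa using hxU j
  | succ i =>
    have h := he.1 ⟨i, by omega⟩ j
    rw [hX, hU] at h
    simp only at h ⊢
    rw [Function.iterate_succ_apply', B.F_V, h]
    by_cases hij : i = j
    · rw [if_pos (Fin.ext hij), if_pos (by omega), map_one]
    · rw [if_neg (fun h => hij (congrArg Fin.val h)), if_neg (by omega), map_zero]

/-- If `p` divided the coordinate of `U_d` along `X_1 = x`, then `U_d ∈ FM`, so `Y_d = V U_d ∈ pM`,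
contradicting `⟨X_d, Y_d⟩ = 1`. -/
lemma isUnit_repr_inl (i j : Fin d) (hi : (i : ℕ) = 0) (hj : (j : ℕ) + 1 = d) :
    IsUnit (e.repr (U j) (Sum.inl i)) := by
  refine isUnit_of_not_p_dvd ?_
  rintro ⟨c, hc⟩
  have hmem : U j ∈ LinearMap.range D.F := by
    rw [← e.sum_repr (U j), Fintype.sum_sum_type]
    refine Submodule.add_mem _ (Submodule.sum_mem _ fun l _ => ?_)
      (Submodule.sum_mem _ fun l _ => ?_)
    · by_cases hl : (l : ℕ) = 0
      · obtain rfl : l = i := Fin.ext (hl.trans hi.symm)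
        rw [hc, mul_smul]
        exact ⟨_, D.F_V _⟩
      · obtain ⟨n, hn⟩ := Nat.exists_eq_succ_of_ne_zero hl
        refine Submodule.smul_mem _ _ ?_
        rw [hX, hn, Function.iterate_succ_apply']
        exact ⟨_, rfl⟩
    · have := l.2
      rw [repr_inr_eq he hX hU hxU, if_neg (by omega), zero_smul]
      exact Submodule.zero_mem _
  obtain ⟨w, hw⟩ := hmem
  have h := he.1 j j
  rw [hU, ← hw, D.V_F, map_smul, if_pos rfl, smul_eq_mul] at h
  exact not_p_dvd_one (k := k) (h ▸ dvd_mul_right _ _)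

lemma isNormalForm_displayMatrix
    (hx : ∀ i, i ≠ 0 → i ≤ d → B.pairing x (D.F^[i] x) = if i = d then 1 else 0) :
    Display.IsNormalForm p (D.displayMatrix e U) := by
  have hF : ∀ j : Fin d, D.F (e (Sum.inl j)) = D.F^[(j : ℕ) + 1] x := fun j => by
    rw [hX, Function.iterate_succ_apply']
  refine ⟨?_, isUnit_repr_inl he hX hU hxU⟩
  unfold Display.toFMatrix Display.normalShape
  congr 1
  · refine Matrix.ext fun i j => ?_
    change e.repr (D.F (e (Sum.inl j))) (Sum.inl i) =
      if (j : ℕ) + 1 = d then e.repr (D.F (e (Sum.inl j))) (Sum.inl i)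
        else if (i : ℕ) = j + 1 then 1 else 0
    by_cases hj : (j : ℕ) + 1 = d
    · rw [if_pos hj]
    · have := j.2
      rw [if_neg hj, hF, ← hX ⟨j + 1, by omega⟩, e.repr_self, Finsupp.single_apply]
      simp only [Sum.inl.injEq, Fin.ext_iff, eq_comm]
  · refine Matrix.ext fun i j => ?_
    change e.repr (D.F (e (Sum.inl j))) (Sum.inr i) =
      if (i : ℕ) = 0 ∧ (j : ℕ) + 1 = d then 1 else 0
    rw [he.repr_inr, hF, hX]
    by_cases hj : (j : ℕ) + 1 = d
    · rw [hj, pairing_iterate_F_iterate_F_dim B hx]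
      simp only [and_true]
    · have := j.2
      rw [if_neg (fun h => hj h.2)]
      exact pairing_iterate_F_eq_zero B hx i ⟨j + 1, by omega⟩
  · refine Matrix.ext fun i j => ?_
    change (p : WittVector p k) * e.repr (U j) (Sum.inr i) =
      if (i : ℕ) = j + 1 then (p : WittVector p k) else 0
    rw [repr_inr_eq he hX hU hxU, mul_ite, mul_one, mul_zero]

end

end DieudonneModule

theorem mainTheorem10 (p : ℕ) [Fact p.Prime] (k : Type*) [Field k] [CharP k p] [IsAlgClosed k]
    (M : Type*) [AddCommGroup M] [Module (WittVector p k) M]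
    [Module.Free (WittVector p k) M] [Module.Finite (WittVector p k) M]
    (D : DieudonneModule p k M) (B : D.PrincipalQuasiPolarization) (d : ℕ)
    (hformal : D.IsFormal) (hd : D.dimension = (d : ℕ∞))
    (hf : D.HasPRank 0) (ha : D.aNumber = 1) :
    ∃ (e : Module.Basis (Fin d ⊕ Fin d) (WittVector p k) M)
      (a : Matrix (Fin d ⊕ Fin d) (Fin d ⊕ Fin d) (WittVector p k)),
      B.IsSymplectic e ∧ D.IsDisplayedBy e a ∧
      D.FMatrix e = Display.toFMatrix p a ∧ Display.IsNormalForm p a := by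
  have hF := B.exists_iterate_F_eq_smul_of_isFormal hformal
  obtain ⟨x, hgen, hx⟩ := DieudonneModule.exists_isGenerator_pairing_iterate_F_eq B hF hd ha
  obtain ⟨U, hXY, hY, hxU⟩ := DieudonneModule.exists_symplectic_complement B hx
  have hX := DieudonneModule.pairing_iterate_F_eq_zero B hx
  have hspan := B.span_sumElim_eq_top hX hXY hY (fun j => ⟨U j, rfl⟩)
    (hgen.span_sup_range_V hF hd)
  let e := Module.Basis.mk (B.linearIndependent_sumElim hX hXY hY) hspan.ge
  have hel : ∀ i, e (Sum.inl i) = D.F^[(i : ℕ)] x := fun i => Module.Basis.mk_apply _ _ _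
  have her : ∀ j, e (Sum.inr j) = D.V (U j) := fun j => Module.Basis.mk_apply _ _ _
  have he : B.IsSymplectic e := by
    refine ⟨fun i j => ?_, fun i j => ?_, fun i j => ?_⟩
    · rw [hel, her, hXY]
    · rw [hel, hel, hX]
    · rw [her, her, hY]
  exact ⟨e, D.displayMatrix e U, he, DieudonneModule.isDisplayedBy_displayMatrix her,
    DieudonneModule.FMatrix_eq_toFMatrix_displayMatrix her,
    DieudonneModule.isNormalForm_displayMatrix he hel her hxU hx⟩
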